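/- A point $p\in\mathbb{R}^d$ is encapsulated by the convex sets $K_1,\dots,K_n\subset\mathbb{R}^d$ if for some $\epsilon>0$ one has $B(p,\epsilon)\setminus\bigcup_{i=1}^n K_i=\{p\}$, where $B(p,\epsilon)$ is the open ball of radius $\epsilon$ centered at $p$. Let $f(d,n)$ be the maximal number of points that can be encapsulated by $n$ nonempty, not necessarily distinct, convex sets in $\mathbb{R}^d$ (in particular $f(0,n)=0$ for all $n\ge 1$). Then for all integers $n>3$ and $d\ge 2$, $$f(d,n)\le \sum_{i=2}^{n-1}\binom{n}{i} f(d,i)+f(d-2,n),$$ and consequently $$f(d,n)\le 2\,d^{\,n-2}\,n!.$$ In particular the maximum $f(d,n)$ is finite. -/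

import Mathlib

/-- The point `p` is encapsulated by the sets `K i`: they cover a pointed neighbourhood of `p`,
but not `p` itself. -/
def Encapsulated {d n : ℕ} (K : Fin n → Set (EuclideanSpace ℝ (Fin d)))
    (p : EuclideanSpace ℝ (Fin d)) : Prop :=
  ∃ ε : ℝ, 0 < ε ∧ Metric.ball p ε \ (⋃ i, K i) = {p}

/-- The maximal number of points that can be encapsulated by `n` (nonempty) convex sets in `ℝ^d`,
as a supremum in `ℕ∞`; when it is finite it is attained, since then the values are bounded
natural numbers. Nonemptiness only matters for `d = 0`: for `1 ≤ d` an empty member can be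
replaced by a copy of a nonempty one, while for `d = 0` and `1 ≤ n` it gives the value `0`. -/
noncomputable def maxEncapsulated (d n : ℕ) : ℕ∞ :=
  ⨆ (K : Fin n → Set (EuclideanSpace ℝ (Fin d))) (_ : ∀ i, Convex ℝ (K i) ∧ (K i).Nonempty),
    {p | Encapsulated K p}.encard

/-! A common point x of convex sets encapsulating p is impossible: points just beyond p, opposite x,
lie in some set, which then contains p (`EncapsulatedBy.iInter_eq_empty`). A convex set with
interior has the same interior as its closure, so the intersection of the closures cannot span the
space either. An encapsulated point either survives the loss of some set, or is essential and lies
in every closure. Essential points thus span at most a hyperplane, which gives f(d,n) ≤ n f(d,n-1) +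
f(d-1,n) and, by double induction, the factorial bound. If they span exactly a hyperplane, it
contains all encapsulated points (`affineSpan_insert_essentialPoints_ne_top`), so the recursion can
be used inside it; otherwise the codimension is at least 2. Either way f(d-1,n) improves to f(d-2,n)
(`maxEncapsulated_add_two_le`), and n f(d,n-1) is the last term of the sum. -/

open Filter Topology Module

/-! ### Encapsulation as a local property -/

section Topological

variable {ι V W : Type*} [NormedAddCommGroup V] [NormedAddCommGroup W]

/-- The sets `K i` cover a pointed neighbourhood of `p`, but not `p` itself. -/
def EncapsulatedBy (K : ι → Set V) (p : V) : Prop :=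
  (∀ i, p ∉ K i) ∧ ∀ᶠ x in 𝓝 p, x ≠ p → ∃ i, x ∈ K i

theorem EncapsulatedBy.preimage {K : ι → Set V} {f : W → V} {w : W}
    (h : EncapsulatedBy K (f w)) (hf : Continuous f) (hinj : Function.Injective f) :
    EncapsulatedBy (fun i => f ⁻¹' K i) w :=
  ⟨h.1, (hf.continuousAt.eventually h.2).mono fun _ hx hne => hx (hinj.ne hne)⟩

/-- The sets whose closure misses `p` are not needed to encapsulate `p`. -/
theorem EncapsulatedBy.restrict [Finite ι] {κ : Type*} {K : ι → Set V} {p : V}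
    (h : EncapsulatedBy K p) (f : κ → ι) (hf : ∀ i, p ∈ closure (K i) → i ∈ Set.range f) :
    EncapsulatedBy (fun k => K (f k)) p := by
  refine ⟨fun k => h.1 _, ?_⟩
  have hfar : ∀ i, ∀ᶠ x in 𝓝 p, x ∈ K i → i ∈ Set.range f := by
    intro i
    by_cases hi : p ∈ closure (K i)
    · exact Eventually.of_forall fun _ _ => hf i hi
    · have := isClosed_closure.isOpen_compl.mem_nhds (show p ∈ (closure (K i))ᶜ from hi)
      filter_upwards [this] with x hx hxK
      exact absurd (subset_closure hxK) hx
  filter_upwards [h.2, eventually_all.2 hfar] with x hx hx' hne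
  obtain ⟨i, hi⟩ := hx hne
  obtain ⟨k, rfl⟩ := hx' i hi
  exact ⟨k, hi⟩

/-- Encapsulation survives raising the dimension by one, provided there are two sets to spare for
the two new half-spaces. -/
theorem EncapsulatedBy.prod_real {K : ι → Set V} {p : V} (h : EncapsulatedBy K p) {s : ι → ℝ}
    (hpos : ∃ i, 0 < s i) (hneg : ∃ i, s i < 0) :
    EncapsulatedBy (fun i => {x : V × ℝ | 0 < s i * x.2 ∨ x.2 = 0 ∧ x.1 ∈ K i}) (p, 0) := by
  refine ⟨fun i => by simpa using h.1 i, ?_⟩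
  have := (continuous_fst.continuousAt (x := ((p, 0) : V × ℝ))).eventually h.2
  filter_upwards [this] with ⟨y, t⟩ hy hne
  rcases lt_trichotomy t 0 with ht | rfl | ht
  · obtain ⟨i, hi⟩ := hneg
    exact ⟨i, Or.inl (mul_pos_of_neg_of_neg hi ht)⟩
  · obtain ⟨i, hi⟩ := hy (fun hyp => hne (by simpa using hyp))
    exact ⟨i, Or.inr ⟨rfl, hi⟩⟩
  · obtain ⟨i, hi⟩ := hpos
    exact ⟨i, Or.inl (mul_pos hi ht)⟩

end Topological

/-! ### Convexity: no common point, no spanning intersection -/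

section Convex

variable {ι V : Type*} [NormedAddCommGroup V] [NormedSpace ℝ V]

theorem EncapsulatedBy.exists_nonempty [Nontrivial V] {K : ι → Set V} {p : V}
    (h : EncapsulatedBy K p) : ∃ i, (K i).Nonempty := by
  have := Module.punctured_nhds_neBot ℝ V p
  obtain ⟨y, i, hi⟩ := Eventually.exists (f := 𝓝[≠] p) (eventually_nhdsWithin_iff.2 h.2)
  exact ⟨i, y, hi⟩

theorem EncapsulatedBy.iInter_eq_empty [Nontrivial V] {K : ι → Set V} {p : V}
    (h : EncapsulatedBy K p) (hK : ∀ i, Convex ℝ (K i)) : ⋂ i, K i = ∅ := by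
  rw [Set.eq_empty_iff_forall_notMem]
  intro x hx
  rw [Set.mem_iInter] at hx
  have hne : x ≠ p := by
    rintro rfl
    obtain ⟨i, -⟩ := h.exists_nonempty
    exact h.1 i (hx i)
  have hcont : ContinuousAt (fun t : ℝ => p - t • (x - p)) 0 := by fun_prop
  have hev : ∀ᶠ t : ℝ in 𝓝 0, p - t • (x - p) ≠ p → ∃ i, p - t • (x - p) ∈ K i := by
    have h2 : ∀ᶠ y in 𝓝 (p - (0 : ℝ) • (x - p)), y ≠ p → ∃ i, y ∈ K i := by simpa using h.2
    exact hcont.eventually h2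
  obtain ⟨t, ht, ht0⟩ := ((eventually_nhdsWithin_of_eventually_nhds hev).and
    (self_mem_nhdsWithin (s := Set.Ioi (0 : ℝ)))).exists
  have ht0 : 0 < t := ht0
  obtain ⟨i, hi⟩ := ht (by simp [sub_eq_zero, ht0.ne', hne])
  refine h.1 i ?_
  -- These weights express p as a convex combination of p - t(x - p) and x.
  have := hK i hi (hx i) (a := 1 / (1 + t)) (b := t / (1 + t)) (by positivity) (by positivity)
    (by field_simp)
  convert this using 1
  have h1 : (1 + t) ≠ 0 := by positivity
  match_scalars <;> field_simp <;> ring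

theorem EncapsulatedBy.affineSpan_iInter_closure_ne_top [FiniteDimensional ℝ V] [Nontrivial V]
    [Finite ι] {K : ι → Set V} {p : V} (h : EncapsulatedBy K p) (hK : ∀ i, Convex ℝ (K i)) :
    affineSpan ℝ (⋂ i, closure (K i)) ≠ ⊤ := by
  intro htop
  obtain ⟨x, hx⟩ := ((convex_iInter fun i => (hK i).closure).interior_nonempty_iff_affineSpan_eq_top).2
    htop
  have hmem : x ∈ ⋂ i, K i := by
    refine Set.mem_iInter.2 fun i => ?_
    have hspan : affineSpan ℝ (K i) = ⊤ := by
      refine top_le_iff.1 (htop ▸ affineSpan_le.2 ?_)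
      exact (Set.iInter_subset _ i).trans (closure_minimal (subset_affineSpan ℝ _)
        (AffineSubspace.closed_of_finiteDimensional _))
    have hi := interior_mono (Set.iInter_subset _ i) hx
    rw [(hK i).interior_closure_eq_interior_of_nonempty_interior
      ((hK i).interior_nonempty_iff_affineSpan_eq_top.2 hspan)] at hi
    exact interior_subset hi
  rw [h.iInter_eq_empty hK] at hmem
  exact hmem

theorem Convex.halfSpace_union_prod {C : Set V} (hC : Convex ℝ C) (s : ℝ) :
    Convex ℝ {x : V × ℝ | 0 < s * x.2 ∨ x.2 = 0 ∧ x.1 ∈ C} := by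
  rw [convex_iff_forall_pos]
  rintro ⟨x, t⟩ hx ⟨y, u⟩ hy a b ha hb hab
  simp only [Set.mem_ofPred_eq, Prod.smul_mk, Prod.mk_add_mk, smul_eq_mul] at hx hy ⊢
  have key : s * (a * t + b * u) = a * (s * t) + b * (s * u) := by ring
  rw [key]
  rcases hx with hx | ⟨rfl, hx⟩ <;> rcases hy with hy | ⟨rfl, hy⟩
  · left; positivity
  · left; simpa using mul_pos ha hx
  · left; simpa using mul_pos hb hy
  · right; exact ⟨by simp, hC hx hy ha.le hb.le hab⟩

end Convex

/-! ### Transfer to other spaces and to affine subspaces -/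

theorem encapsulated_iff {d n : ℕ} (K : Fin n → Set (EuclideanSpace ℝ (Fin d)))
    (p : EuclideanSpace ℝ (Fin d)) : Encapsulated K p ↔ EncapsulatedBy K p := by
  unfold Encapsulated EncapsulatedBy
  rw [Metric.eventually_nhds_iff]
  constructor
  · rintro ⟨ε, hε, h⟩
    have hp : p ∈ Metric.ball p ε \ ⋃ i, K i := by rw [h]; rfl
    refine ⟨fun i hi => hp.2 (Set.mem_iUnion.2 ⟨i, hi⟩), ε, hε, fun y hy hne => ?_⟩
    by_contra hc
    have : y ∈ Metric.ball p ε \ ⋃ i, K i := ⟨hy, by simpa using hc⟩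
    rw [h] at this
    exact hne this
  · rintro ⟨hp, ε, hε, h⟩
    refine ⟨ε, hε, Set.eq_singleton_iff_unique_mem.2
      ⟨⟨Metric.mem_ball_self hε, by simpa using hp⟩, fun y hy => ?_⟩⟩
    by_contra hne
    exact hy.2 (Set.mem_iUnion.2 (h hy.1 hne))

theorem encard_le_maxEncapsulated_of_nonempty {V : Type*} [NormedAddCommGroup V] [NormedSpace ℝ V]
    [FiniteDimensional ℝ V] {n : ℕ} (K : Fin n → Set V) (hK : ∀ i, Convex ℝ (K i))
    (hne : ∀ i, (K i).Nonempty) :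
    {p | EncapsulatedBy K p}.encard ≤ maxEncapsulated (finrank ℝ V) n := by
  let e : EuclideanSpace ℝ (Fin (finrank ℝ V)) ≃L[ℝ] V :=
    ContinuousLinearEquiv.ofFinrankEq (by simp)
  have hsub : e.symm '' {p | EncapsulatedBy K p} ⊆
      {q | Encapsulated (fun i => e ⁻¹' K i) q} := by
    rintro _ ⟨p, hp, rfl⟩
    refine (encapsulated_iff _ _).2 (EncapsulatedBy.preimage ?_ e.continuous e.injective)
    simpa using hp
  rw [← e.symm.injective.encard_image]
  refine (Set.encard_le_encard hsub).trans (le_iSup₂_of_le (fun i => e ⁻¹' K i) (fun i => ?_) le_rfl)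
  exact ⟨(hK i).linear_preimage e.toLinearMap, (hne i).preimage e.surjective⟩

theorem encard_le_maxEncapsulated_finrank {V : Type*} [NormedAddCommGroup V] [NormedSpace ℝ V]
    [FiniteDimensional ℝ V] [Nontrivial V] {n : ℕ} (K : Fin n → Set V)
    (hK : ∀ i, Convex ℝ (K i)) :
    {p | EncapsulatedBy K p}.encard ≤ maxEncapsulated (finrank ℝ V) n := by
  classical
  rcases Set.eq_empty_or_nonempty {p | EncapsulatedBy K p} with h | ⟨p, hp⟩
  · simp [h]
  obtain ⟨j, hj⟩ := EncapsulatedBy.exists_nonempty hp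
  let K' : Fin n → Set V := fun i => if (K i).Nonempty then K i else K j
  refine le_trans (Set.encard_le_encard ?_) (encard_le_maxEncapsulated_of_nonempty K' ?_ ?_)
  · rintro q ⟨hq, hev⟩
    refine ⟨fun i => ?_, hev.mono fun x hx hne => ?_⟩
    · simp only [K']; split_ifs <;> exact hq _
    · obtain ⟨i, hi⟩ := hx hne
      exact ⟨i, by simpa only [K', if_pos (Set.nonempty_of_mem hi)] using hi⟩
  · intro i; simp only [K']; split_ifs <;> exact hK _
  · intro i; simp only [K']; split_ifs with h
    exacts [h, hj]

theorem encard_le_maxEncapsulated {m n : ℕ} (hm : 1 ≤ m) (hn : 2 ≤ n) {V : Type*}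
    [NormedAddCommGroup V] [NormedSpace ℝ V] [FiniteDimensional ℝ V] (hV : finrank ℝ V ≤ m)
    (K : Fin n → Set V) (hK : ∀ i, Convex ℝ (K i)) :
    {p | EncapsulatedBy K p}.encard ≤ maxEncapsulated m n := by
  obtain ⟨k, hk⟩ := Nat.exists_eq_add_of_le hV
  induction k generalizing V with
  | zero =>
    subst hk
    have : Nontrivial V := Module.nontrivial_of_finrank_pos (R := ℝ) (by omega)
    exact encard_le_maxEncapsulated_finrank K hK
  | succ k ih =>
    have hfin : finrank ℝ (V × ℝ) = finrank ℝ V + 1 := by simp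
    -- Set 0 gains the open upper half-space and all others the lower one; both occur because `2 ≤
    -- n`.
    let s : Fin n → ℝ := fun i => if (i : ℕ) = 0 then 1 else -1
    have hpos : ∃ i, 0 < s i := ⟨⟨0, by omega⟩, by simp [s]⟩
    have hneg : ∃ i, s i < 0 := ⟨⟨1, by omega⟩, by simp [s]⟩
    refine le_trans ?_ (ih (V := V × ℝ) (by omega)
      (fun i => {x : V × ℝ | 0 < s i * x.2 ∨ x.2 = 0 ∧ x.1 ∈ K i})
      (fun i => (hK i).halfSpace_union_prod _) (by omega))
    rw [← (Prod.mk_left_injective (0 : ℝ)).encard_image]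
    refine Set.encard_le_encard ?_
    rintro _ ⟨p, hp, rfl⟩
    exact EncapsulatedBy.prod_real hp hpos hneg

theorem encard_inter_le_maxEncapsulated {m n : ℕ} (hm : 1 ≤ m) (hn : 2 ≤ n) {V : Type*}
    [NormedAddCommGroup V] [NormedSpace ℝ V] [FiniteDimensional ℝ V] (K : Fin n → Set V)
    (hK : ∀ i, Convex ℝ (K i)) (L : AffineSubspace ℝ V) (hL : finrank ℝ L.direction ≤ m) :
    {p | p ∈ L ∧ EncapsulatedBy K p}.encard ≤ maxEncapsulated m n := by
  rcases Set.eq_empty_or_nonempty {p | p ∈ L ∧ EncapsulatedBy K p} with h | ⟨q, hq, -⟩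
  · simp [h]
  let f : L.direction → V := fun w => (w : V) + q
  have hf : Continuous f := by fun_prop
  have hinj : Function.Injective f := fun a b hab => Subtype.ext (add_right_cancel hab)
  have hconv : ∀ i, Convex ℝ (f ⁻¹' K i) := fun i =>
    ((hK i).translate_preimage_left q).linear_preimage L.direction.subtype
  refine le_trans ?_ (encard_le_maxEncapsulated hm hn hL _ hconv)
  rw [← hinj.encard_image]
  refine Set.encard_le_encard ?_
  rintro p ⟨hp, hpK⟩
  refine ⟨⟨p - q, L.vsub_mem_direction hp hq⟩, ?_, by simp [f]⟩
  exact EncapsulatedBy.preimage (by simpa [f] using hpK) hf hinj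

section Essential

variable {V : Type*} [NormedAddCommGroup V] {n : ℕ}

/-- The points encapsulated by all the sets `K i` together, but by no `n` of these `n + 1` sets. -/
def essentialPoints (K : Fin (n + 1) → Set V) : Set V :=
  {p | EncapsulatedBy K p ∧ ∀ j : Fin (n + 1), ¬ EncapsulatedBy (fun i => K (j.succAbove i)) p}

theorem mem_closure_of_mem_essentialPoints {K : Fin (n + 1) → Set V} {p : V}
    (hp : p ∈ essentialPoints K) (j : Fin (n + 1)) : p ∈ closure (K j) := by
  by_contra hj
  refine hp.2 j (hp.1.restrict j.succAbove fun i hi => ?_)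
  rw [Fin.range_succAbove]
  rintro rfl
  exact hj hi

theorem encard_encapsulatedBy_le (K : Fin (n + 1) → Set V) {M : ℕ∞}
    (hM : ∀ j : Fin (n + 1), {p | EncapsulatedBy (fun i => K (j.succAbove i)) p}.encard ≤ M) :
    {p | EncapsulatedBy K p}.encard ≤ (n + 1 : ℕ) * M + (essentialPoints K).encard := by
  have hsub : {p | EncapsulatedBy K p} ⊆
      (⋃ j : Fin (n + 1), {p | EncapsulatedBy (fun i => K (j.succAbove i)) p})
        ∪ essentialPoints K := by
    intro p hp
    by_cases h : ∃ j : Fin (n + 1), EncapsulatedBy (fun i => K (j.succAbove i)) p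
    · exact Or.inl (Set.mem_iUnion.2 h)
    · exact Or.inr ⟨hp, not_exists.1 h⟩
  refine (Set.encard_le_encard hsub).trans ((Set.encard_union_le _ _).trans ?_)
  gcongr
  refine (Set.encard_iUnion_le_of_fintype _).trans ((Finset.sum_le_sum fun j _ => hM j).trans ?_)
  simp

variable [NormedSpace ℝ V] [FiniteDimensional ℝ V]

theorem finrank_direction_affineSpan_lt {s : Set V} (hs : affineSpan ℝ s ≠ ⊤) (hne : s.Nonempty) :
    finrank ℝ (affineSpan ℝ s).direction < finrank ℝ V := by
  refine Submodule.finrank_lt (lt_top_iff_ne_top.2 fun h => hs ?_).ne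
  exact (AffineSubspace.direction_eq_top_iff_of_nonempty (hne.affineSpan ℝ)).1 h

theorem encard_essentialPoints_le_one {K : Fin (n + 1) → Set V}
    (hdim : finrank ℝ (affineSpan ℝ (essentialPoints K)).direction = 0) :
    (essentialPoints K).encard ≤ 1 := by
  refine Set.encard_le_one_iff.2 fun a b ha hb => ?_
  have h := AffineSubspace.vsub_mem_direction (subset_affineSpan ℝ _ ha)
    (subset_affineSpan ℝ _ hb)
  rw [Submodule.finrank_eq_zero.1 hdim] at h
  simpa [sub_eq_zero] using h

theorem encard_essentialPoints_le {m : ℕ} (hm : 1 ≤ m) (hn : 1 ≤ n) {K : Fin (n + 1) → Set V}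
    (hK : ∀ i, Convex ℝ (K i))
    (hdim : finrank ℝ (affineSpan ℝ (essentialPoints K)).direction ≤ m) :
    (essentialPoints K).encard ≤ maxEncapsulated m (n + 1) :=
  (Set.encard_le_encard (t := {p | p ∈ affineSpan ℝ (essentialPoints K) ∧ EncapsulatedBy K p})
    fun _ hp => ⟨subset_affineSpan ℝ _ hp, hp.1⟩).trans
    (encard_inter_le_maxEncapsulated hm (by omega) K hK (affineSpan ℝ (essentialPoints K)) hdim)

variable [Nontrivial V]

/-- The essential points together with any single encapsulated point do not span the space. -/
theorem affineSpan_insert_essentialPoints_ne_top {K : Fin (n + 1) → Set V}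
    (hK : ∀ i, Convex ℝ (K i)) {p : V} (hp : EncapsulatedBy K p) :
    affineSpan ℝ (insert p (essentialPoints K)) ≠ ⊤ := by
  -- Only the sets with p in their closure matter near p, and their closures contain all essential
  -- points too.
  have hp' : EncapsulatedBy (fun i : {i // p ∈ closure (K i)} => K i) p :=
    hp.restrict Subtype.val fun i hi => ⟨⟨i, hi⟩, rfl⟩
  refine fun htop => hp'.affineSpan_iInter_closure_ne_top (fun i => hK i)
    (top_le_iff.1 (htop ▸ affineSpan_mono ℝ ?_))
  refine Set.insert_subset (Set.mem_iInter.2 fun i => i.2) fun q hq => Set.mem_iInter.2 fun i => ?_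
  exact mem_closure_of_mem_essentialPoints hq i

theorem finrank_direction_essentialPoints_lt {K : Fin (n + 1) → Set V}
    (hK : ∀ i, Convex ℝ (K i)) :
    finrank ℝ (affineSpan ℝ (essentialPoints K)).direction < finrank ℝ V := by
  rcases (essentialPoints K).eq_empty_or_nonempty with h | ⟨q, hq⟩
  · rw [h, AffineSubspace.span_empty, AffineSubspace.direction_bot, finrank_bot]
    exact finrank_pos
  · refine finrank_direction_affineSpan_lt ?_ ⟨q, hq⟩
    simpa [Set.insert_eq_of_mem hq] using affineSpan_insert_essentialPoints_ne_top hK hq.1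

/-- If the essential points span a hyperplane, then it contains all encapsulated points. -/
theorem EncapsulatedBy.mem_affineSpan_essentialPoints {K : Fin (n + 1) → Set V}
    (hK : ∀ i, Convex ℝ (K i)) {p : V} (hp : EncapsulatedBy K p)
    (hne : (essentialPoints K).Nonempty)
    (hdim : finrank ℝ V ≤ finrank ℝ (affineSpan ℝ (essentialPoints K)).direction + 1) :
    p ∈ affineSpan ℝ (essentialPoints K) := by
  have hle := affineSpan_mono ℝ (Set.subset_insert p (essentialPoints K))
  have hlt := finrank_direction_affineSpan_lt (affineSpan_insert_essentialPoints_ne_top hK hp)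
    (Set.insert_nonempty _ _)
  have hdir := Submodule.eq_of_le_of_finrank_le (AffineSubspace.direction_le hle) (by omega)
  rw [AffineSubspace.eq_of_direction_eq_of_nonempty_of_le hdir (hne.affineSpan ℝ) hle]
  exact mem_affineSpan ℝ (Set.mem_insert _ _)

end Essential

/-! ### Recursions and bounds -/

theorem maxEncapsulated_le {d n : ℕ} {M : ℕ∞}
    (h : ∀ K : Fin n → Set (EuclideanSpace ℝ (Fin d)), (∀ i, Convex ℝ (K i)) →
      (∀ i, (K i).Nonempty) → {p | EncapsulatedBy K p}.encard ≤ M) :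
    maxEncapsulated d n ≤ M :=
  iSup₂_le fun K hK => by
    simpa only [encapsulated_iff] using h K (fun i => (hK i).1) fun i => (hK i).2

theorem encard_encapsulatedBy_le_of_convex {d n : ℕ}
    {K : Fin (n + 1) → Set (EuclideanSpace ℝ (Fin d))} (hK : ∀ i, Convex ℝ (K i))
    (hne : ∀ i, (K i).Nonempty) :
    {p | EncapsulatedBy K p}.encard ≤
      (n + 1 : ℕ) * maxEncapsulated d n + (essentialPoints K).encard := by
  refine encard_encapsulatedBy_le K fun j => ?_
  have := encard_le_maxEncapsulated_of_nonempty (fun i => K (j.succAbove i)) (fun i => hK _)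
    fun i => hne _
  rwa [finrank_euclideanSpace_fin] at this

theorem maxEncapsulated_mono {m d n : ℕ} (hm : 1 ≤ m) (hmd : m ≤ d) (hn : 2 ≤ n) :
    maxEncapsulated m n ≤ maxEncapsulated d n :=
  maxEncapsulated_le fun K hK _ =>
    encard_le_maxEncapsulated (hm.trans hmd) hn (by simpa using hmd) K hK

theorem one_le_maxEncapsulated {d n : ℕ} (hd : 1 ≤ d) (hn : 2 ≤ n) :
    1 ≤ maxEncapsulated d n := by
  -- Empty sets vacuously encapsulate the only point of a 0-dimensional space; padding the dimension
  -- makes this a genuine example.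
  have h := encard_le_maxEncapsulated hd hn (V := EuclideanSpace ℝ (Fin 0)) (by simp)
    (fun _ => ∅) fun _ => convex_empty
  have h0 : (0 : EuclideanSpace ℝ (Fin 0)) ∈
      {p | EncapsulatedBy (fun _ : Fin n => (∅ : Set (EuclideanSpace ℝ (Fin 0)))) p} :=
    ⟨fun _ => id, Eventually.of_forall fun x hx => absurd (Subsingleton.elim x 0) hx⟩
  exact (Set.one_le_encard_iff_nonempty.2 ⟨_, h0⟩).trans h

theorem maxEncapsulated_one_right {d : ℕ} (hd : 1 ≤ d) : maxEncapsulated d 1 = 0 := by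
  have : Nonempty (Fin d) := ⟨⟨0, hd⟩⟩
  refine le_antisymm (maxEncapsulated_le fun K hK hne => ?_) zero_le
  rw [nonpos_iff_eq_zero, Set.encard_eq_zero, Set.eq_empty_iff_forall_notMem]
  intro p hp
  obtain ⟨x, hx⟩ := hne 0
  have h := EncapsulatedBy.iInter_eq_empty hp hK
  exact Set.eq_empty_iff_forall_notMem.1 h x
    (Set.mem_iInter.2 fun i => by rwa [Subsingleton.elim i 0])

theorem maxEncapsulated_one_left_le (n : ℕ) :
    maxEncapsulated 1 (n + 1) ≤ (n + 1 : ℕ) * maxEncapsulated 1 n + 1 := by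
  refine maxEncapsulated_le fun K hK hne => (encard_encapsulatedBy_le_of_convex hK hne).trans ?_
  gcongr
  have := finrank_direction_essentialPoints_lt hK
  rw [finrank_euclideanSpace_fin] at this
  exact encard_essentialPoints_le_one (by omega)

theorem maxEncapsulated_succ_le {d n : ℕ} (hd : 1 ≤ d) (hn : 1 ≤ n) :
    maxEncapsulated (d + 1) (n + 1) ≤
      (n + 1 : ℕ) * maxEncapsulated (d + 1) n + maxEncapsulated d (n + 1) := by
  refine maxEncapsulated_le fun K hK hne => (encard_encapsulatedBy_le_of_convex hK hne).trans ?_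
  gcongr
  have := finrank_direction_essentialPoints_lt hK
  rw [finrank_euclideanSpace_fin] at this
  exact encard_essentialPoints_le hd hn hK (by omega)

theorem encard_encapsulatedBy_le_or {d n : ℕ} (hn : 1 ≤ n)
    {K : Fin (n + 1) → Set (EuclideanSpace ℝ (Fin (d + 2)))} (hK : ∀ i, Convex ℝ (K i)) :
    {p | EncapsulatedBy K p}.encard ≤ maxEncapsulated (d + 1) (n + 1) ∨
      finrank ℝ (affineSpan ℝ (essentialPoints K)).direction ≤ d := by
  refine or_iff_not_imp_right.2 fun hdim => ?_
  have hlt := finrank_direction_essentialPoints_lt hK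
  rw [finrank_euclideanSpace_fin] at hlt
  have hne : (essentialPoints K).Nonempty := by
    rw [Set.nonempty_iff_ne_empty]
    intro h
    rw [h, AffineSubspace.span_empty, AffineSubspace.direction_bot, finrank_bot] at hdim
    omega
  refine (Set.encard_le_encard
    (t := {p | p ∈ affineSpan ℝ (essentialPoints K) ∧ EncapsulatedBy K p})
    fun p hp => ⟨?_, hp⟩).trans (encard_inter_le_maxEncapsulated (by omega) (by omega) K hK
      (affineSpan ℝ (essentialPoints K)) (by omega))
  exact EncapsulatedBy.mem_affineSpan_essentialPoints hK hp hne (by rw [finrank_euclideanSpace_fin]; omega)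

/-- A 0-dimensional span can hold one essential point although f(0,n) = 0, hence the extra 1. -/
theorem maxEncapsulated_two_le {n : ℕ} (hn : 2 ≤ n) :
    maxEncapsulated 2 (n + 1) ≤ (n + 1 : ℕ) * maxEncapsulated 2 n + 1 := by
  refine maxEncapsulated_le fun K hK hne => ?_
  rcases encard_encapsulatedBy_le_or (d := 0) (by omega) hK with h | h
  · refine h.trans ((maxEncapsulated_one_left_le n).trans ?_)
    gcongr
    exact maxEncapsulated_mono le_rfl (by omega) hn
  · refine (encard_encapsulatedBy_le_of_convex hK hne).trans ?_
    gcongr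
    exact encard_essentialPoints_le_one (Nat.le_zero.1 h)

theorem maxEncapsulated_add_two_le {d n : ℕ} (hd : 1 ≤ d) (hn : 2 ≤ n) :
    maxEncapsulated (d + 2) (n + 1) ≤
      (n + 1 : ℕ) * maxEncapsulated (d + 2) n + maxEncapsulated d (n + 1) := by
  refine maxEncapsulated_le fun K hK hne => ?_
  rcases encard_encapsulatedBy_le_or (by omega) hK with h | h
  · refine h.trans ((maxEncapsulated_succ_le hd (by omega)).trans ?_)
    gcongr
    exact maxEncapsulated_mono (by omega) (by omega) hn
  · refine (encard_encapsulatedBy_le_of_convex hK hne).trans ?_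
    gcongr
    exact encard_essentialPoints_le hd (by omega) hK h

/-- The 1 on the left absorbs the additive 1 of the recursion, so that the induction closes. -/
theorem maxEncapsulated_one_left_add_one_le (n : ℕ) :
    maxEncapsulated 1 (n + 1) + 1 ≤ ((2 * (n + 1).factorial : ℕ) : ℕ∞) := by
  induction n with
  | zero => simp [maxEncapsulated_one_right le_rfl]
  | succ n ih =>
    calc maxEncapsulated 1 (n + 2) + 1
        ≤ ((n + 2 : ℕ) * maxEncapsulated 1 (n + 1) + 1) + 1 := by
          gcongr; exact maxEncapsulated_one_left_le (n + 1)
      _ = (n + 2 : ℕ) * maxEncapsulated 1 (n + 1) + (2 : ℕ) := by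
          rw [add_assoc]; norm_num
      _ ≤ (n + 2 : ℕ) * maxEncapsulated 1 (n + 1) + (n + 2 : ℕ) := by
          gcongr; omega
      _ = (n + 2 : ℕ) * (maxEncapsulated 1 (n + 1) + 1) := by rw [mul_add, mul_one]
      _ ≤ (n + 2 : ℕ) * ((2 * (n + 1).factorial : ℕ) : ℕ∞) := by gcongr
      _ = ((2 * (n + 1 + 1).factorial : ℕ) : ℕ∞) := by
          rw [Nat.factorial_succ (n + 1)]; push_cast; ring

theorem maxEncapsulated_le_two_mul_pow_mul_factorial (d n : ℕ) :
    maxEncapsulated (d + 1) (n + 2) ≤ ((2 * (d + 1) ^ n * (n + 2).factorial : ℕ) : ℕ∞) := by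
  induction d generalizing n with
  | zero => simpa using le_self_add.trans (maxEncapsulated_one_left_add_one_le (n + 1))
  | succ d ihd =>
    induction n with
    | zero =>
      refine (maxEncapsulated_succ_le (by omega) le_rfl).trans ?_
      rw [maxEncapsulated_one_right (by omega), mul_zero, zero_add]
      simpa using ihd 0
    | succ n ihn =>
      refine (maxEncapsulated_succ_le (by omega) (by omega)).trans
        ((add_le_add (mul_le_mul_right ihn _) (ihd (n + 1))).trans ?_)
      norm_cast
      have hpow : (d + 1) ^ n ≤ (d + 1 + 1) ^ n := Nat.pow_le_pow_left (by omega) n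
      calc (n + 2 + 1) * (2 * (d + 1 + 1) ^ n * (n + 2).factorial)
            + 2 * (d + 1) ^ (n + 1) * (n + 1 + 2).factorial
          = 2 * (n + 2 + 1).factorial * ((d + 1 + 1) ^ n + (d + 1) * (d + 1) ^ n) := by
            rw [Nat.factorial_succ (n + 2)]; ring
        _ ≤ 2 * (n + 2 + 1).factorial * ((d + 1 + 1) ^ n + (d + 1) * (d + 1 + 1) ^ n) := by
            gcongr
        _ = 2 * (d + 1 + 1) ^ (n + 1) * (n + 1 + 2).factorial := by ring

theorem theorem2 (d n : ℕ) (hd : 2 ≤ d) (hn : 3 < n) :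
    maxEncapsulated d n ≤
        (∑ i ∈ Finset.Icc 2 (n - 1), (n.choose i : ℕ∞) * maxEncapsulated d i)
          + maxEncapsulated (d - 2) n ∧
      maxEncapsulated d n ≤ ((2 * d ^ (n - 2) * n.factorial : ℕ) : ℕ∞) := by
  obtain ⟨d, rfl⟩ := Nat.exists_eq_add_of_le' hd
  obtain ⟨n, rfl⟩ := Nat.exists_eq_add_of_le' hn
  refine ⟨?_, maxEncapsulated_le_two_mul_pow_mul_factorial (d + 1) (n + 2)⟩
  have hlast : ((n + 4 : ℕ) : ℕ∞) = ((n + 4).choose (n + 3) : ℕ∞) := by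
    rw [Nat.choose_succ_self_right]
  rcases Nat.eq_zero_or_pos d with rfl | hd0
  · refine (maxEncapsulated_two_le (by omega)).trans (le_trans ?_ le_self_add)
    rw [hlast]
    have hne : n + 3 ≠ 2 := by omega
    -- The term i = 2 is at least 1 and pays for the extra 1; it differs from the last term because
    -- n > 3.
    have hsub : ({n + 3, 2} : Finset ℕ) ⊆ Finset.Icc 2 (n + 4 - 1) := by
      intro i hi
      simp only [Finset.mem_insert, Finset.mem_singleton] at hi
      rw [Finset.mem_Icc]
      omega
    refine le_trans ?_ (Finset.sum_le_sum_of_subset hsub)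
    rw [Finset.sum_pair hne]
    gcongr
    refine le_mul_of_one_le_of_le ?_ (one_le_maxEncapsulated (by omega) le_rfl)
    exact_mod_cast Nat.choose_pos (by omega)
  · refine (maxEncapsulated_add_two_le hd0 (by omega)).trans ?_
    rw [hlast]
    refine add_le_add ?_ le_rfl
    exact Finset.single_le_sum (f := fun i => ((n + 4).choose i : ℕ∞) * maxEncapsulated (d + 2) i)
      (fun _ _ => zero_le) (Finset.mem_Icc.2 ⟨by omega, by omega⟩)
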